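/- Let $\mathscr A$ be a totally ordered alphabet, let $w$ be a word of length $n$ over $\mathscr A$, and let $R(w)$ be the rearrangement class of $w$, that is, the set of all words obtained by permuting the letters of $w$. For a word $v=v_1v_2\cdots v_n$ over $\mathscr A$, let $c(v)\in\mathcal S_n$ be its standardization, the unique permutation such that $c(v)_i<c(v)_j$ if and only if $v_i<v_j$, or $v_i=v_j$ and $i<j$. Define $$D(v)=\{i:\ 1\le i<n,\ v_i>v_{i+1}\},\qquad Id(v)=\{c(v)_i:\ \exists\, j<i \text{ such that } c(v)_j=c(v)_i+1\},$$ $$\mathrm{des}\,v=|D(v)|,\quad \mathrm{ides}\,v=|Id(v)|,\quad \mathrm{MAJ}\,v=\sum_{j\in D(v)}j,\quad \mathrm{IMAJ}\,v=\sum_{j\in Id(v)}j,\quad \mathrm F\,v=v_1,$$ $$\mathrm{STAT}\,v=(\underline{21}3+\underline{21}2+\underline{13}2+\underline{12}1+\underline{32}1+\underline{21})\,v,$$ where $(\tau)v$ denotes the number of occurrences of the vincular pattern $\tau$ in $v$, i.e. of subsequences of $v$ (choices of positions) whose letters are order-isomorphic to $\tau$ (equal letters corresponding to equal letters) and in which the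 letters corresponding to the underlined letters of $\tau$ are adjacent in $v$. (For the empty word, which has no first letter, $\mathrm F$ is given a fixed dummy value.) Then the statistics $$(\mathrm{IMAJ},\mathrm{des},\mathrm{ides},\mathrm F,\mathrm{MAJ},\mathrm{STAT})\quad\text{and}\quad(\mathrm{IMAJ},\mathrm{des},\mathrm{ides},\mathrm F,\mathrm{STAT},\mathrm{MAJ})$$ have the same joint distribution on $R(w)$: for every sextuple of values, the number of $v\in R(w)$ at which the first tuple takes that value equals the number of $v\in R(w)$ at which the second does. -/

import Mathlib

namespace WordStat

/-- A word `w = w₁ w₂ ⋯ wₙ` over an alphabet `α` is a function `Fin n → α`; the letter at the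
(one-based) position `k` is the value of `w` at the index `k - 1`. Its rearrangement class `R(w)`
is the finite set of all the (distinct) words obtained by permuting its letters. -/
def rearr {α : Type*} [LinearOrder α] {n : ℕ} (w : Fin n → α) : Finset (Fin n → α) :=
  Finset.univ.image fun σ : Equiv.Perm (Fin n) => w ∘ σ

/-- The coding map: `code w` is the permutation `c(w)` that standardises `w`. Indices and values
are zero-based here. Its defining property is `eq_code_iff`. -/
def code {α : Type*} [LinearOrder α] {n : ℕ} (w : Fin n → α) : Equiv.Perm (Fin n) :=
  (Tuple.sort w).symm

/-- `code w` is the unique permutation `π` such that `π i < π j` iff `w i < w j`, or `w i = w j`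
and `i < j`. -/
theorem eq_code_iff {α : Type*} [LinearOrder α] {n : ℕ} (w : Fin n → α)
    (π : Equiv.Perm (Fin n)) :
    π = code w ↔ ∀ i j, π i < π j ↔ (w i < w j ∨ (w i = w j ∧ i < j)) := by
  have key : π = code w ↔ π.symm = Tuple.sort w := by
    unfold code
    constructor
    · rintro rfl
      simp
    · intro h
      rw [← h, Equiv.symm_symm]
  rw [key, Tuple.eq_sort_iff]
  constructor
  · rintro ⟨hm, hs⟩
    have main : ∀ i j, π i < π j → (w i < w j ∨ (w i = w j ∧ i < j)) := by
      intro i j hij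
      have h1 := hm hij.le
      have h2 := hs _ _ hij
      simp only [Function.comp_apply, Equiv.symm_apply_apply] at h1 h2
      rcases h1.lt_or_eq with h | h
      · exact Or.inl h
      · exact Or.inr ⟨h, h2 h⟩
    intro i j
    refine ⟨main i j, fun h => ?_⟩
    rcases lt_trichotomy (π i) (π j) with h1 | h1 | h1
    · exact h1
    · have := π.injective h1
      subst this
      simp at h
    · exfalso
      rcases main j i h1 with h2 | ⟨h2, h3⟩ <;> rcases h with h4 | ⟨h4, h5⟩
      · exact absurd h2 h4.asymm
      · exact absurd h4 h2.ne'
      · exact absurd h2 h4.ne'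
      · exact absurd h3 h5.asymm
  · intro h
    constructor
    · intro a b hab
      rcases hab.lt_or_eq with hlt | rfl
      · have := (h (π.symm a) (π.symm b)).1 (by simpa using hlt)
        rcases this with h1 | h1
        · exact h1.le
        · exact h1.1.le
      · exact le_rfl
    · intro a b hab he
      have := (h (π.symm a) (π.symm b)).1 (by simpa using hab)
      rcases this with h1 | h1
      · exact absurd he h1.ne
      · exact h1.2

/-- The descent set `D(w) = {i : wᵢ > wᵢ₊₁, 1 ≤ i < n}`, a set of one-based positions. -/
def descentSet {α : Type*} [LinearOrder α] {n : ℕ} (w : Fin n → α) : Finset ℕ :=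
  (Finset.univ.filter fun i : Fin n => ∃ j : Fin n, (j : ℕ) = (i : ℕ) + 1 ∧ w j < w i).image
    fun i : Fin n => (i : ℕ) + 1

/-- The inverse descent set `Id(w) = {c(w)ᵢ : c(w)ⱼ = c(w)ᵢ + 1 for some j < i}`, a set of
one-based values of `c(w)`. -/
def invDescentSet {α : Type*} [LinearOrder α] {n : ℕ} (w : Fin n → α) : Finset ℕ :=
  (Finset.univ.filter fun i : Fin n =>
      ∃ j : Fin n, j < i ∧ (code w j : ℕ) = (code w i : ℕ) + 1).image
    fun i : Fin n => (code w i : ℕ) + 1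

/-- The number of occurrences in `w` of the vincular pattern with letters `p`, in which for every
`a ∈ A` the letters at the (zero-based) places `a` and `a + 1` of the pattern are underlined
together. An occurrence is a strictly increasing choice `e` of positions such that the chosen
letters of `w` compare with each other (equality included) exactly as the letters of `p` do, and
such that the positions chosen for letters underlined together are adjacent. -/
def patternCount {α : Type*} [LinearOrder α] {n k : ℕ} (p : Fin k → ℕ) (A : Finset (Fin k))
    (w : Fin n → α) : ℕ :=
  (Finset.univ.filter fun e : Fin k → Fin n =>
    StrictMono e ∧
    (∀ a b : Fin k, w (e a) < w (e b) ↔ p a < p b) ∧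
    (∀ a ∈ A, ∀ b : Fin k, (b : ℕ) = (a : ℕ) + 1 → (e b : ℕ) = (e a : ℕ) + 1)).card

/-- The first letter of `w` (`none` for the empty word, which has no first letter). -/
def firstLetter {α : Type*} [LinearOrder α] {n : ℕ} (w : Fin n → α) : Option α :=
  if h : 0 < n then some (w ⟨0, h⟩) else none

/-- `des w`, the number of descents. -/
def des {α : Type*} [LinearOrder α] {n : ℕ} (w : Fin n → α) : ℕ :=
  (descentSet w).card

/-- `ides w`, the number of inverse descents. -/
def ides {α : Type*} [LinearOrder α] {n : ℕ} (w : Fin n → α) : ℕ :=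
  (invDescentSet w).card

/-- `MAJ w`, the sum of the elements of the descent set. -/
def maj {α : Type*} [LinearOrder α] {n : ℕ} (w : Fin n → α) : ℕ :=
  ∑ j ∈ descentSet w, j

/-- `IMAJ w`, the sum of the elements of the inverse descent set. -/
def imaj {α : Type*} [LinearOrder α] {n : ℕ} (w : Fin n → α) : ℕ :=
  ∑ j ∈ invDescentSet w, j

/-- `STAT w`, the total number of occurrences of the vincular patterns
`213`, `212`, `132`, `121`, `321` and `21`, each with its first two letters underlined. -/
def stat {α : Type*} [LinearOrder α] {n : ℕ} (w : Fin n → α) : ℕ :=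
  patternCount ![2, 1, 3] {0} w + patternCount ![2, 1, 2] {0} w +
  patternCount ![1, 3, 2] {0} w + patternCount ![1, 2, 1] {0} w +
  patternCount ![3, 2, 1] {0} w + patternCount ![2, 1] {0} w

end WordStat

namespace WordStat

open LaurentPolynomial

/-! ### Leveled words (MacMahon's method). -/

/-- The number of descents of a list. -/
def listDes {α : Type*} [LinearOrder α] : List α → ℕ
  | [] => 0
  | [_] => 0
  | a :: b :: l => (if b < a then 1 else 0) + listDes (b :: l)

/-- The sum of the zero-based positions of the descents of a list. -/
def listMaj {α : Type*} [LinearOrder α] : List α → ℕ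
  | [] => 0
  | [_] => 0
  | _ :: b :: l => listDes (b :: l) + listMaj (b :: l)

/-- A letter together with a level. Letters of a higher level come first, and letters of the same
level are ordered as in the alphabet. -/
abbrev Leveled (α : Type*) := ℕᵒᵈ ×ₗ α

namespace Leveled

/-- The letter `x` put at level `b`. -/
def mk {α : Type*} (b : ℕ) (x : α) : Leveled α := toLex (OrderDual.toDual b, x)

/-- The level of a leveled letter. -/
def level {α : Type*} (p : Leveled α) : ℕ := OrderDual.ofDual (ofLex p).1

/-- The underlying letter of a leveled letter. -/
def letter {α : Type*} (p : Leveled α) : α := (ofLex p).2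

variable {α : Type*}

@[simp] theorem level_mk (b : ℕ) (x : α) : (mk b x).level = b := rfl
@[simp] theorem letter_mk (b : ℕ) (x : α) : (mk b x).letter = x := rfl
@[simp] theorem mk_eta (p : Leveled α) : mk p.level p.letter = p := rfl

theorem mk_le_iff [LinearOrder α] (b : ℕ) (x : α) (p : Leveled α) :
    mk b x ≤ p ↔ p.level < b ∨ (p.level = b ∧ x ≤ p.letter) := by
  rw [Prod.Lex.le_iff, eq_comm (a := p.level)]
  rfl

/-- The complement of levels: levels `0, …, s` are reversed for the letters that are at least `f`,
and levels `0, …, s - 1` are reversed for the others. -/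
def compl [LinearOrder α] (s : ℕ) (f : α) (p : Leveled α) : Leveled α :=
  mk ((if f ≤ p.letter then s else s - 1) - p.level) p.letter

/-- The hypothesis bounds the level by s for letters at least f, and by s - 1 for smaller letters,
which it excludes when s = 0. Hence the truncated subtractions in `compl` are genuine ones. -/
theorem mk_le_compl [LinearOrder α] {s : ℕ} {f : α} {p : Leveled α} (h : mk s f ≤ p) :
    mk s f ≤ compl s f p := by
  rw [mk_le_iff] at *
  simp only [compl, level_mk, letter_mk]
  by_cases hf : f ≤ p.letter <;>
    simp only [hf, if_true, if_false, and_true, and_false, or_false] at h ⊢ <;> omega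

theorem compl_compl [LinearOrder α] {s : ℕ} {f : α} {p : Leveled α} (h : mk s f ≤ p) :
    compl s f (compl s f p) = p := by
  rw [mk_le_iff] at h
  conv_rhs => rw [← mk_eta p]
  simp only [compl, level_mk, letter_mk]
  congr 1
  by_cases hf : f ≤ p.letter <;>
    simp only [hf, if_true, if_false, and_true, and_false, or_false] at h ⊢ <;> omega

theorem level_compl [LinearOrder α] {s : ℕ} {f : α} {p : Leveled α} (h : mk s f ≤ p) :
    ((compl s f p).level : ℤ) = s - (if p.letter < f then 1 else 0) - p.level := by
  rw [mk_le_iff] at h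
  simp only [compl, level_mk]
  simp only [← not_le]
  by_cases hf : f ≤ p.letter <;>
    simp only [hf, if_true, if_false, and_true, and_false, or_false, not_true, not_false_eq_true]
      at h ⊢ <;> omega

/-- The sum of the levels in a list of leveled letters. -/
def weight (L : List (Leveled α)) : ℕ := (L.map level).sum

/-- The ways of leveling the word `u` such that `mk s f` followed by the result is sorted. -/
def liftings [LinearOrder α] : ℕ → α → List α → Finset (List (Leveled α))
  | _, _, [] => {[]}
  | s, f, g :: u => (Finset.range (if g < f then s else s + 1)).biUnion fun b =>
      (liftings b g u).image (List.cons (mk b g))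

/-- Sortedness only has to be checked on neighbours: the level may stay the same across a weak
ascent and must drop at a descent, which is what the two ranges in `liftings` encode. -/
theorem mem_liftings [LinearOrder α] (u : List α) : ∀ (s : ℕ) (f : α) (L : List (Leveled α)),
    L ∈ liftings s f u ↔ (mk s f :: L).Pairwise (· ≤ ·) ∧ L.map letter = u := by
  induction u with
  | nil => intro s f L; simp +contextual [liftings]
  | cons g u ih =>
    intro s f L
    simp only [liftings, Finset.mem_biUnion, Finset.mem_range, Finset.mem_image]
    constructor
    · rintro ⟨b, hb, L, hL, rfl⟩
      obtain ⟨h1, h2⟩ := (ih _ _ _).1 hL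
      refine ⟨?_, by simp [h2]⟩
      rw [← List.isChain_iff_pairwise] at *
      rw [List.isChain_cons_cons]
      refine ⟨?_, h1⟩
      rw [mk_le_iff]
      simp only [level_mk, letter_mk]
      by_cases hg : g < f
      · simp only [hg, if_true] at hb; omega
      · simp only [hg, if_false] at hb
        have := not_lt.1 hg
        simp only [this, and_true]
        omega
    · rintro ⟨h1, h2⟩
      cases L with
      | nil => simp at h2
      | cons p L =>
        simp only [List.map_cons, List.cons.injEq] at h2
        obtain ⟨rfl, h2⟩ := h2
        refine ⟨p.level, ?_, L, (ih _ _ _).2 ⟨h1.tail, h2⟩, rfl⟩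
        have := (List.pairwise_cons.1 h1).1 p (by simp)
        rw [mk_le_iff] at this
        by_cases hg : p.letter < f
        · simp only [hg, if_true, not_le.2 hg, and_false, or_false] at *; omega
        · simp only [hg, if_false, not_lt.1 hg] at *; omega

end Leveled

open Leveled

/-! ### Symmetry of MAJ for a fixed first letter and number of descents. -/

/-- The generating function of the weakly decreasing sequences of `N` levels that are at most `s`,
by the sum of the levels. -/
noncomputable def levelPoly : ℕ → ℕ → ℤ[T;T⁻¹]
  | 0, _ => 1
  | N + 1, s => ∑ b ∈ Finset.range (s + 1), T (b : ℤ) * levelPoly N b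

theorem levelPoly_zero_right (N : ℕ) : levelPoly N 0 = 1 := by
  induction N with
  | zero => rfl
  | succ N ih => simp [levelPoly, ih]

/-- Each letter of u has level at least the number of descents from it onwards; these minimal levels
add up to `listMaj (f :: u)`. Subtracting them leaves an arbitrary weakly decreasing sequence of
levels at most s minus the number of descents. -/
theorem sum_liftings {α : Type*} [LinearOrder α] (u : List α) : ∀ (s : ℕ) (f : α),
    ∑ L ∈ liftings s f u, (T (weight L : ℤ) : ℤ[T;T⁻¹]) =
      if listDes (f :: u) ≤ s then
        T (listMaj (f :: u) : ℤ) * levelPoly u.length (s - listDes (f :: u)) else 0 := by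
  induction u with
  | nil => intro s f; simp [liftings, listDes, listMaj, levelPoly, weight]
  | cons g u ih =>
    intro s f
    rw [liftings, Finset.sum_biUnion]
    · have h1 : ∀ b, ∑ L ∈ (liftings b g u).image (List.cons (mk b g)),
          (T (weight L : ℤ) : ℤ[T;T⁻¹]) =
          if listDes (g :: u) ≤ b then T (b : ℤ) * (T (listMaj (g :: u) : ℤ) *
            levelPoly u.length (b - listDes (g :: u))) else 0 := by
        intro b
        rw [Finset.sum_image (fun _ _ _ _ h => (List.cons.inj h).2)]
        have : ∀ L : List (Leveled α), (T (weight (mk b g :: L) : ℤ) : ℤ[T;T⁻¹]) =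
            T (b : ℤ) * T (weight L : ℤ) := by
          intro L
          rw [← T_add]
          simp [weight]
        simp only [this, ← Finset.mul_sum, ih]
        split_ifs <;> simp
      simp only [h1]
      -- Reindexing by b - d removes the d descents of the tail from the level of the current
      -- letter.
      have key : ∀ (m d : ℕ) (F : ℕ → ℤ[T;T⁻¹]),
          ∑ b ∈ Finset.range m, (if d ≤ b then T (b : ℤ) * F (b - d) else 0) =
          ∑ b ∈ Finset.range (m - d), T (d : ℤ) * (T (b : ℤ) * F b) := by
        intro m d F
        rw [← Finset.sum_filter]
        refine Finset.sum_nbij' (fun b => b - d) (fun b => b + d) ?_ ?_ ?_ ?_ ?_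
        · intro b hb; simp at *; omega
        · intro b hb; simp at *; omega
        · intro b hb; simp at *; omega
        · intro b hb; simp at *
        · intro b hb
          simp only [Finset.mem_filter] at hb
          rw [← mul_assoc, ← T_add]
          congr 2
          omega
      rw [key _ _ fun b => T (listMaj (g :: u) : ℤ) * levelPoly u.length b]
      have h2 : ∀ b : ℕ, T (listDes (g :: u) : ℤ) * (T (b : ℤ) * (T (listMaj (g :: u) : ℤ) *
          levelPoly u.length b)) = T (listMaj (f :: g :: u) : ℤ) *
            (T (b : ℤ) * levelPoly u.length b) := by
        intro b
        rw [listMaj, Nat.cast_add, T_add]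
        ring
      simp only [h2, ← Finset.mul_sum]
      rw [listDes]
      split_ifs with hg h3 h3
      · rw [List.length_cons, levelPoly]
        congr 3
        omega
      · rw [Nat.sub_eq_zero_of_le (by omega)]; simp
      · rw [List.length_cons, levelPoly]
        congr 3
        omega
      · rw [Nat.sub_eq_zero_of_le (by omega)]; simp
    · intro b _ b' _ hbb
      refine Finset.disjoint_left.2 fun L h1 h2 => hbb ?_
      obtain ⟨L1, _, rfl⟩ := Finset.mem_image.1 h1
      obtain ⟨L2, _, h⟩ := Finset.mem_image.1 h2
      exact (congrArg level (List.cons.inj h).1).symm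

/-- The words with the letters of the multiset `c`. -/
def multisetWords {α : Type*} [LinearOrder α] (c : Multiset α) : Finset (List α) :=
  c.lists.toFinset

theorem mem_multisetWords {α : Type*} [LinearOrder α] (c : Multiset α) (u : List α) :
    u ∈ multisetWords c ↔ (u : Multiset α) = c := by
  rw [multisetWords, Multiset.mem_toFinset, Multiset.mem_lists_iff, eq_comm]
  rfl

/-- Summed over all words with content c, the liftings are exactly the multisets of leveled letters
that are at least `mk s f` and have letters c. Complementing levels is an involution on these,
sending the weight to s times the number of letters, minus the number of letters below f, minus the
weight. -/
theorem invert_sum_liftings {α : Type*} [LinearOrder α] (c : Multiset α) (f : α) (s : ℕ) :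
    invert (∑ u ∈ multisetWords c, ∑ L ∈ liftings s f u, (T (weight L : ℤ) : ℤ[T;T⁻¹])) =
      T ((c.filter (· < f)).card - s * c.card : ℤ) *
        ∑ u ∈ multisetWords c, ∑ L ∈ liftings s f u, (T (weight L : ℤ) : ℤ[T;T⁻¹]) := by
  have hd : Set.PairwiseDisjoint (multisetWords c : Set (List α)) (liftings s f) := by
    intro u _ v _ huv
    refine Finset.disjoint_left.2 fun L h1 h2 => huv ?_
    rw [mem_liftings] at h1 h2
    rw [← h1.2, h2.2]
  rw [← Finset.sum_biUnion hd, map_sum, Finset.mul_sum]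
  have hm : ∀ L, L ∈ (multisetWords c).biUnion (liftings s f) ↔
      ((∀ p ∈ L, mk s f ≤ p) ∧ L.Pairwise (· ≤ ·)) ∧ (L : Multiset (Leveled α)).map letter = c := by
    intro L
    simp only [Finset.mem_biUnion, mem_multisetWords, mem_liftings, List.pairwise_cons,
      Multiset.map_coe]
    constructor
    · rintro ⟨u, rfl, h, rfl⟩; exact ⟨h, rfl⟩
    · rintro ⟨h, h'⟩; exact ⟨_, h', h, rfl⟩
  -- Complementing does not preserve the order, so the list is sorted again; the underlying word may
  -- change, but not its content.
  let φ : List (Leveled α) → List (Leveled α) := fun L =>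
    ((L : Multiset (Leveled α)).map (compl s f)).sort (· ≤ ·)
  have hφ : ∀ L, ((φ L : List (Leveled α)) : Multiset (Leveled α)) =
      (L : Multiset (Leveled α)).map (compl s f) := fun L => Multiset.sort_eq _ _
  have hmem : ∀ L ∈ (multisetWords c).biUnion (liftings s f),
      φ L ∈ (multisetWords c).biUnion (liftings s f) := by
    intro L hL
    rw [hm] at *
    refine ⟨⟨?_, Multiset.pairwise_sort _ _⟩, ?_⟩
    · intro p hp
      rw [Multiset.mem_sort, Multiset.mem_map] at hp
      obtain ⟨q, hq, rfl⟩ := hp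
      exact mk_le_compl (hL.1.1 q hq)
    · rw [hφ, Multiset.map_map, ← hL.2]
      rfl
  have hinv : ∀ L ∈ (multisetWords c).biUnion (liftings s f), φ (φ L) = L := by
    intro L hL
    rw [hm] at hL
    refine List.Perm.eq_of_pairwise (le := (· ≤ ·)) (fun _ _ _ _ => le_antisymm)
      (Multiset.pairwise_sort _ _) hL.1.2 ?_
    rw [← Multiset.coe_eq_coe, hφ, hφ, Multiset.map_map]
    conv_rhs => rw [← Multiset.map_id (L : Multiset (Leveled α))]
    exact Multiset.map_congr rfl fun p hp => compl_compl (hL.1.1 p hp)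
  refine Finset.sum_nbij' φ φ hmem hmem hinv hinv ?_
  intro L hL
  rw [invert_T, ← T_add]
  congr 1
  have hw : ∀ L : List (Leveled α), (weight L : ℤ) =
      ((L : Multiset (Leveled α)).map fun p => (p.level : ℤ)).sum := by
    intro L; simp [weight, Function.comp_def]
  rw [hm] at hL
  rw [hw, hw, hφ, Multiset.map_map, ← hL.2]
  have h0 := hL.1.1
  clear hL
  induction L with
  | nil => simp
  | cons p L ih =>
    have h1 := ih fun q hq => h0 q (by simp [hq])
    have h2 := level_compl (h0 p (by simp))
    simp only [Function.comp_apply, ← Multiset.cons_coe, Multiset.map_cons, Multiset.sum_cons,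
      Multiset.card_cons, Multiset.filter_cons] at *
    rw [h2]
    split_ifs
    · simp only [Multiset.card_add, Multiset.card_singleton]
      push_cast
      linarith
    · simp only [Multiset.card_add, Multiset.card_zero]
      push_cast
      linarith

theorem listDes_replicate {α : Type*} [LinearOrder α] (f : α) (N : ℕ) :
    listDes (List.replicate N f) = 0 := by
  induction N with
  | zero => rfl
  | succ N ih => cases N with
    | zero => rfl
    | succ N => simp only [List.replicate_succ, listDes, lt_irrefl, if_false] at *; simpa using ih

theorem listMaj_replicate {α : Type*} [LinearOrder α] (f : α) (N : ℕ) :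
    listMaj (List.replicate N f) = 0 := by
  induction N with
  | zero => rfl
  | succ N ih => cases N with
    | zero => rfl
    | succ N =>
      have := listDes_replicate f (N + 1)
      simp only [List.replicate_succ, listMaj] at *; omega

/-- The case of a constant word, which has a single rearrangement and no descents. -/
theorem invert_levelPoly (N s : ℕ) :
    invert (levelPoly N s) = T (-(s * N) : ℤ) * levelPoly N s := by
  have h := invert_sum_liftings (Multiset.replicate N 0) (0 : ℕ) s
  have h1 : multisetWords (Multiset.replicate N 0) = {List.replicate N (0 : ℕ)} := by
    ext u
    rw [mem_multisetWords, Finset.mem_singleton, ← Multiset.coe_replicate, Multiset.coe_eq_coe,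
      List.perm_replicate]
  have h2 : listDes (0 :: List.replicate N 0) = 0 := listDes_replicate 0 (N + 1)
  have h3 : listMaj (0 :: List.replicate N 0) = 0 := listMaj_replicate 0 (N + 1)
  simpa [h1, sum_liftings, h2, h3] using h

/-- The generating function by `listMaj` of the words `f :: u` with `d` descents, where `u` has
the letters of `c`. -/
noncomputable def majPoly {α : Type*} [LinearOrder α] (c : Multiset α) (f : α) (d : ℕ) :
    ℤ[T;T⁻¹] :=
  ∑ u ∈ (multisetWords c).filter (fun u => listDes (f :: u) = d), T (listMaj (f :: u) : ℤ)

theorem sum_liftings_eq_sum_majPoly {α : Type*} [LinearOrder α] (c : Multiset α) (f : α) (s : ℕ) :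
    ∑ u ∈ multisetWords c, ∑ L ∈ liftings s f u, (T (weight L : ℤ) : ℤ[T;T⁻¹]) =
      ∑ d ∈ Finset.range (s + 1), majPoly c f d * levelPoly c.card (s - d) := by
  simp only [sum_liftings, majPoly, Finset.sum_mul, Finset.sum_filter]
  rw [Finset.sum_comm]
  refine Finset.sum_congr rfl fun u hu => ?_
  have hc : u.length = c.card := by
    rw [mem_multisetWords] at hu
    rw [← hu, Multiset.coe_card]
  simp only [ite_mul, zero_mul, Finset.sum_ite_eq, Finset.mem_range, hc, Nat.lt_succ_iff]

/-- Strong induction on s: in the symmetric sum over d ≤ s the terms with d < s are symmetric with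
the same exponent, by induction and `invert_levelPoly`, and the term d = s has factor `levelPoly
c.card 0`, which is 1. Cancelling leaves the claim. -/
theorem invert_majPoly {α : Type*} [LinearOrder α] (c : Multiset α) (f : α) (s : ℕ) :
    invert (majPoly c f s) =
      T ((c.filter (· < f)).card - s * c.card : ℤ) * majPoly c f s := by
  induction s using Nat.strong_induction_on with
  | _ s ih =>
    have h := invert_sum_liftings c f s
    rw [sum_liftings_eq_sum_majPoly, Finset.sum_range_succ, Nat.sub_self, levelPoly_zero_right,
      mul_one, mul_add, map_add, map_sum] at h
    have h1 : ∑ d ∈ Finset.range s, invert (majPoly c f d * levelPoly c.card (s - d)) =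
        T ((c.filter (· < f)).card - s * c.card : ℤ) *
          ∑ d ∈ Finset.range s, majPoly c f d * levelPoly c.card (s - d) := by
      rw [Finset.mul_sum]
      refine Finset.sum_congr rfl fun d hd => ?_
      rw [Finset.mem_range] at hd
      rw [map_mul, ih d hd, invert_levelPoly, mul_mul_mul_comm, ← T_add]
      congr 2
      rw [Nat.cast_sub hd.le]
      ring
    rw [h1] at h
    exact add_left_cancel h

theorem coeff_majPoly {α : Type*} [LinearOrder α] (c : Multiset α) (f : α) (d : ℕ) (x : ℤ) :
    (majPoly c f d).coeff x = (((multisetWords c).filter fun u =>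
      listDes (f :: u) = d ∧ (listMaj (f :: u) : ℤ) = x).card : ℤ) := by
  rw [majPoly, ← Finset.filter_filter, Finset.card_filter]
  push_cast
  rw [AddMonoidAlgebra.coeff_sum, Finset.sum_apply']
  simp [Finset.sum_boole, Finset.filter_filter]

/-- Comparison of the coefficients at -x in `invert_majPoly`. -/
theorem card_listMaj_symm {α : Type*} [LinearOrder α] (c : Multiset α) (f : α) (d : ℕ) (x y : ℤ)
    (h : x + y + (c.filter (· < f)).card = d * c.card) :
    ((multisetWords c).filter fun u =>
      listDes (f :: u) = d ∧ (listMaj (f :: u) : ℤ) = x).card =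
    ((multisetWords c).filter fun u =>
      listDes (f :: u) = d ∧ (listMaj (f :: u) : ℤ) = y).card := by
  have h1 := congrArg (fun p => p.coeff (-x)) (invert_majPoly c f d)
  simp only [invert_apply, neg_neg] at h1
  rw [T, AddMonoidAlgebra.coeff_single_mul_apply, one_mul,
    show -((c.filter (· < f)).card - d * c.card : ℤ) + -x = y by linarith, coeff_majPoly,
    coeff_majPoly] at h1
  exact_mod_cast h1

/-! ### Passage from lists to words as functions. -/

theorem sum_descentSet {α : Type*} [LinearOrder α] {n : ℕ} (v : Fin (n + 1) → α) (g : ℕ → ℕ) :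
    ∑ j ∈ descentSet v, g j =
      ∑ i : Fin n, if v i.succ < v i.castSucc then g (i + 1) else 0 := by
  rw [descentSet, Finset.sum_image (fun i _ j _ h => Fin.ext (Nat.succ_injective h)),
    Finset.sum_filter, Fin.sum_univ_castSucc, if_neg, add_zero]
  · refine Finset.sum_congr rfl fun i _ => ?_
    refine if_congr ⟨?_, fun h => ⟨i.succ, by simp, h⟩⟩ (by simp) rfl
    rintro ⟨j, hj, h⟩
    rwa [show j = i.succ from Fin.ext (by simpa using hj)] at h
  · rintro ⟨j, hj, -⟩
    have := j.2
    simp at hj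
    omega

theorem des_eq_sum {α : Type*} [LinearOrder α] {n : ℕ} (v : Fin (n + 1) → α) :
    des v = ∑ i : Fin n, if v i.succ < v i.castSucc then 1 else 0 := by
  rw [des, Finset.card_eq_sum_ones, sum_descentSet v fun _ => 1]

theorem maj_eq_sum {α : Type*} [LinearOrder α] {n : ℕ} (v : Fin (n + 1) → α) :
    maj v = ∑ i : Fin n, if v i.succ < v i.castSucc then (i : ℕ) + 1 else 0 :=
  sum_descentSet v fun j => j

theorem listDes_ofFn {α : Type*} [LinearOrder α] : ∀ {n : ℕ} (v : Fin (n + 1) → α),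
    listDes (List.ofFn v) = des v
  | 0, v => by simp [des_eq_sum, listDes]
  | n + 1, v => by
    have ih := listDes_ofFn fun i : Fin (n + 1) => v i.succ
    rw [des_eq_sum] at *
    rw [Fin.sum_univ_succ, List.ofFn_succ, List.ofFn_succ, listDes,
      ← List.ofFn_succ (f := fun i => v i.succ), ih]
    simp
    rfl

/-- Positions count from zero in `listMaj` and from one in `maj`, a difference of one per descent.
-/
theorem listMaj_ofFn {α : Type*} [LinearOrder α] : ∀ {n : ℕ} (v : Fin (n + 1) → α),
    listMaj (List.ofFn v) + des v = maj v
  | 0, v => by simp [des_eq_sum, maj_eq_sum, listMaj]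
  | n + 1, v => by
    have ih := listMaj_ofFn fun i : Fin (n + 1) => v i.succ
    have h := listDes_ofFn fun i : Fin (n + 1) => v i.succ
    rw [List.ofFn_succ, List.ofFn_succ, listMaj, ← List.ofFn_succ (f := fun i => v i.succ), h,
      add_comm (des _), ih, maj_eq_sum, maj_eq_sum, des_eq_sum]
    simp only [Fin.sum_univ_succ (n := n)]
    have h2 : ∀ i : Fin n,
        (if v i.succ.succ < v i.succ.castSucc then ((i.succ : Fin (n + 1)) : ℕ) + 1 else 0) =
        (if v i.succ.succ < v i.castSucc.succ then (i : ℕ) + 1 else 0) +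
          if v i.succ.succ < v i.succ.castSucc then 1 else 0 := by
      intro i
      rw [Fin.succ_castSucc]
      split_ifs <;> simp
    simp only [h2, Finset.sum_add_distrib]
    simp only [Fin.val_zero, Fin.succ_zero_eq_one, Fin.castSucc_zero, Fin.succ_castSucc]
    by_cases h01 : v 1 < v 0 <;> simp only [h01, if_true, if_false] <;> omega

theorem mem_rearr_iff {α : Type*} [LinearOrder α] {n : ℕ} (w v : Fin n → α) :
    v ∈ rearr w ↔ (List.ofFn v : Multiset α) = List.ofFn w := by
  rw [Multiset.coe_eq_coe]
  simp only [rearr, Finset.mem_image, Finset.mem_univ, true_and]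
  constructor
  · rintro ⟨σ, rfl⟩
    exact Equiv.Perm.ofFn_comp_perm σ w
  · intro h
    have hs : ∀ u : Fin n → α, (List.ofFn (u ∘ Tuple.sort u)).Pairwise (· ≤ ·) := fun u =>
      List.pairwise_ofFn.2 fun i j hij => Tuple.monotone_sort u hij.le
    have h1 : v ∘ Tuple.sort v = w ∘ Tuple.sort w :=
      List.ofFn_injective <| List.Perm.eq_of_pairwise (fun _ _ _ _ => le_antisymm) (hs v) (hs w) <|
        ((Equiv.Perm.ofFn_comp_perm _ v).trans h).trans (Equiv.Perm.ofFn_comp_perm _ w).symm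
    refine ⟨(Tuple.sort v).symm.trans (Tuple.sort w), ?_⟩
    funext i
    have := congrFun h1 ((Tuple.sort v).symm i)
    simpa using this.symm

/-- The number of letters of the word that are smaller than its first letter. -/
def firstRank {α : Type*} [LinearOrder α] {n : ℕ} (v : Fin (n + 1) → α) : ℕ :=
  (Finset.univ.filter fun k => v k < v 0).card

theorem firstRank_eq_card_filter {α : Type*} [LinearOrder α] {n : ℕ} (v : Fin (n + 1) → α) :
    firstRank v =
      (((List.ofFn fun i : Fin n => v i.succ : List α) : Multiset α).filter (· < v 0)).card := by
  have h : (List.ofFn fun i : Fin n => v i.succ : Multiset α) =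
      Finset.univ.val.map fun i : Fin n => v i.succ := by
    rw [List.ofFn_eq_map, ← Multiset.map_coe]
    rfl
  rw [h, Multiset.filter_map, Multiset.card_map, firstRank, Finset.card_filter,
    Fin.sum_univ_succ, if_neg (lt_irrefl _), zero_add, ← Finset.card_filter]
  rfl

theorem card_des_maj_symm {α : Type*} [LinearOrder α] {n : ℕ} (w : Fin (n + 1) → α) (f : α)
    (d x y : ℕ) (h : ∀ v ∈ rearr w, v 0 = f → x + y + firstRank v = (n + 2) * d) :
    ((rearr w).filter fun v => v 0 = f ∧ des v = d ∧ maj v = x).card =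
    ((rearr w).filter fun v => v 0 = f ∧ des v = d ∧ maj v = y).card := by
  by_cases hv : ∃ v ∈ rearr w, v 0 = f
  swap
  · push Not at hv
    rw [Finset.filter_false_of_mem, Finset.filter_false_of_mem]
    · exact fun v h1 h2 => hv v h1 h2.1
    · exact fun v h1 h2 => hv v h1 h2.1
  obtain ⟨v, hv, rfl⟩ := hv
  have h := h v hv rfl
  set c : Multiset α := ((List.ofFn fun i : Fin n => v i.succ : List α) : Multiset α) with hc
  have hcard : c.card = n := by simp [hc]
  -- Deleting the first letter gives words with content c. The shift by d turns one-based descent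
  -- positions into zero-based ones; it is taken in ℤ because x may be less than d.
  have key : ∀ x, ((rearr w).filter fun u => u 0 = v 0 ∧ des u = d ∧ maj u = x).card =
      ((multisetWords c).filter fun u =>
        listDes (v 0 :: u) = d ∧ (listMaj (v 0 :: u) : ℤ) = (x - d : ℤ)).card := by
    intro x
    have hiff : ∀ u : Fin (n + 1) → α, (u ∈ rearr w ∧ u 0 = v 0 ∧ des u = d ∧ maj u = x) ↔
        u 0 = v 0 ∧ (List.ofFn fun i : Fin n => u i.succ) ∈ multisetWords c ∧
          listDes (v 0 :: List.ofFn fun i : Fin n => u i.succ) = d ∧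
          (listMaj (v 0 :: List.ofFn fun i : Fin n => u i.succ) : ℤ) = (x - d : ℤ) := by
      intro u
      by_cases hu : u 0 = v 0
      · rw [mem_rearr_iff, ← (mem_rearr_iff _ _).1 hv, List.ofFn_succ (f := v), ← hu,
          ← List.ofFn_succ (f := u), listDes_ofFn, mem_multisetWords, ← listMaj_ofFn u,
          List.ofFn_succ (f := u), ← Multiset.cons_coe, ← Multiset.cons_coe,
          Multiset.cons_inj_right, ← hc]
        have : ∀ m : ℕ, des u = d ∧ m + des u = x ↔ des u = d ∧ (m : ℤ) = x - d := by omega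
        simp only [true_and, this]
      · simp [hu]
    refine Finset.card_bij (fun u _ => List.ofFn fun i : Fin n => u i.succ) ?_ ?_ ?_
    · intro u hu
      rw [Finset.mem_filter, hiff] at hu
      rw [Finset.mem_filter]
      exact hu.2
    · intro u hu u' hu' h
      rw [Finset.mem_filter, hiff] at hu hu'
      funext i
      refine Fin.cases (hu.1.trans hu'.1.symm) (fun i => ?_) i
      exact congrFun (List.ofFn_injective h) i
    · intro l hl
      have hlen : l.length = n := by
        rw [Finset.mem_filter, mem_multisetWords] at hl
        rw [← hcard, ← hl.1, Multiset.coe_card]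
      obtain ⟨g, rfl⟩ : ∃ g : Fin n → α, List.ofFn g = l := by
        subst hlen
        exact ⟨l.get, List.ofFn_get l⟩
      refine ⟨Fin.cons (v 0) g, ?_, by simp⟩
      rw [Finset.mem_filter, hiff]
      rw [Finset.mem_filter] at hl
      simpa using hl
  rw [key, key]
  apply card_listMaj_symm
  rw [firstRank_eq_card_filter, ← hc] at h
  rw [hcard]
  zify at h
  linarith

/-! ### The linear relation between MAJ and STAT. -/

theorem patternCount_three {α : Type*} [LinearOrder α] {n : ℕ} (p : Fin 3 → ℕ)
    (v : Fin (n + 1) → α) :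
    patternCount p {0} v = ∑ i : Fin n, ∑ k : Fin (n + 1), if i.succ < k ∧
      ∀ a b : Fin 3, ![v i.castSucc, v i.succ, v k] a < ![v i.castSucc, v i.succ, v k] b ↔
        p a < p b then 1 else 0 := by
  rw [← Fintype.sum_prod_type', ← Finset.card_filter, patternCount, eq_comm]
  have hv : ∀ i j k, v ∘ ![i, j, k] = ![v i, v j, v k] := by
    intro i j k; ext a; fin_cases a <;> rfl
  have hs : ∀ i j k : Fin (n + 1), StrictMono ![i, j, k] ↔ i < j ∧ j < k := by
    intro i j k
    simp [Fin.strictMono_iff_lt_succ, Fin.forall_fin_two]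
  refine Finset.card_bij (fun q _ => ![q.1.castSucc, q.1.succ, q.2]) ?_ ?_ ?_
  · rintro ⟨i, k⟩ h
    simp only [Finset.mem_filter, Finset.mem_univ, true_and] at h ⊢
    refine ⟨(hs _ _ _).2 ⟨Fin.castSucc_lt_succ, h.1⟩, ?_, ?_⟩
    · intro a b
      rw [← h.2 a b, ← hv]
      rfl
    · intro a ha b hb
      rw [Finset.mem_singleton] at ha
      subst ha
      rw [show b = 1 from Fin.ext (by simpa using hb)]
      simp
  · rintro ⟨i, k⟩ _ ⟨i', k'⟩ _ h
    have h1 := congrFun h 1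
    have h2 := congrFun h 2
    simp at h1 h2
    simp [h1, h2]
  · intro e he
    simp only [Finset.mem_filter, Finset.mem_univ, true_and] at he
    obtain ⟨h1, h2, h3⟩ := he
    have h3 := h3 0 (by simp) 1 rfl
    have hlt : (e 0 : ℕ) < n := by have := (e 1).2; omega
    have he : e = ![(⟨e 0, hlt⟩ : Fin n).castSucc, (⟨e 0, hlt⟩ : Fin n).succ, e 2] := by
      funext a
      fin_cases a
      · rfl
      · exact Fin.ext h3
      · rfl
    refine ⟨(⟨e 0, hlt⟩, e 2), ?_, he.symm⟩
    simp only [Finset.mem_filter, Finset.mem_univ, true_and]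
    rw [he] at h1
    refine ⟨((hs _ _ _).1 h1).2, fun a b => ?_⟩
    rw [← h2 a b, ← hv, ← he]
    rfl

theorem patternCount_two {α : Type*} [LinearOrder α] {n : ℕ} (v : Fin (n + 1) → α) :
    patternCount ![2, 1] {0} v = des v := by
  rw [des_eq_sum, ← Finset.card_filter, patternCount, eq_comm]
  refine Finset.card_bij (fun q _ => ![q.castSucc, q.succ]) ?_ ?_ ?_
  · intro i h
    simp only [Finset.mem_filter, Finset.mem_univ, true_and] at h ⊢
    refine ⟨?_, ?_, ?_⟩
    · simp [Fin.strictMono_iff_lt_succ]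
    · simp [Fin.forall_fin_two, h, h.le]
    · simp [Fin.forall_fin_two]
  · intro i _ j _ h
    simpa using congrFun h 1
  · intro e he
    simp only [Finset.mem_filter, Finset.mem_univ, true_and] at he
    obtain ⟨h1, h2, h3⟩ := he
    have h3 := h3 0 (by simp) 1 rfl
    have hlt : (e 0 : ℕ) < n := by have := (e 1).2; omega
    have he : e = ![(⟨e 0, hlt⟩ : Fin n).castSucc, (⟨e 0, hlt⟩ : Fin n).succ] := by
      funext a
      fin_cases a
      · rfl
      · exact Fin.ext h3
    refine ⟨⟨e 0, hlt⟩, ?_, he.symm⟩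
    have := (h2 1 0).2 (by simp)
    rw [he] at this
    simpa using this

/-- With a, b adjacent and c further right, the five patterns together are indicated by [b < a] + [a
≤ c] - [b ≤ c]. The last two terms make the sum over adjacent pairs telescope. -/
theorem sum_patterns {α : Type*} [LinearOrder α] (a b c : α) :
    (((if ∀ s t : Fin 3, ![a, b, c] s < ![a, b, c] t ↔ (![2, 1, 3] s : ℕ) < ![2, 1, 3] t
        then 1 else 0) +
      (if ∀ s t : Fin 3, ![a, b, c] s < ![a, b, c] t ↔ (![2, 1, 2] s : ℕ) < ![2, 1, 2] t
        then 1 else 0) +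
      (if ∀ s t : Fin 3, ![a, b, c] s < ![a, b, c] t ↔ (![1, 3, 2] s : ℕ) < ![1, 3, 2] t
        then 1 else 0) +
      (if ∀ s t : Fin 3, ![a, b, c] s < ![a, b, c] t ↔ (![1, 2, 1] s : ℕ) < ![1, 2, 1] t
        then 1 else 0) +
      (if ∀ s t : Fin 3, ![a, b, c] s < ![a, b, c] t ↔ (![3, 2, 1] s : ℕ) < ![3, 2, 1] t
        then 1 else 0)) + (if b ≤ c then 1 else 0) : ℕ) =
      (if b < a then 1 else 0) + (if a ≤ c then 1 else 0) := by
  have h213 : (∀ s t : Fin 3, ![a, b, c] s < ![a, b, c] t ↔ (![2, 1, 3] s : ℕ) < ![2, 1, 3] t) ↔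
      b < a ∧ a < c := by
    simp [Fin.forall_fin_succ]
    grind
  have h212 : (∀ s t : Fin 3, ![a, b, c] s < ![a, b, c] t ↔ (![2, 1, 2] s : ℕ) < ![2, 1, 2] t) ↔
      b < a ∧ a = c := by
    simp [Fin.forall_fin_succ]
    grind
  have h132 : (∀ s t : Fin 3, ![a, b, c] s < ![a, b, c] t ↔ (![1, 3, 2] s : ℕ) < ![1, 3, 2] t) ↔
      a < c ∧ c < b := by
    simp [Fin.forall_fin_succ]
    grind
  have h121 : (∀ s t : Fin 3, ![a, b, c] s < ![a, b, c] t ↔ (![1, 2, 1] s : ℕ) < ![1, 2, 1] t) ↔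
      a < b ∧ a = c := by
    simp [Fin.forall_fin_succ]
    grind
  have h321 : (∀ s t : Fin 3, ![a, b, c] s < ![a, b, c] t ↔ (![3, 2, 1] s : ℕ) < ![3, 2, 1] t) ↔
      c < b ∧ b < a := by
    simp [Fin.forall_fin_succ]
    grind
  simp only [h213, h212, h132, h121, h321]
  grind

theorem maj_add_stat {α : Type*} [LinearOrder α] {n : ℕ} (v : Fin (n + 1) → α) :
    maj v + stat v + firstRank v = (n + 2) * des v := by
  have h1 : stat v + ∑ i : Fin n, ∑ k : Fin (n + 1), (if i.succ < k ∧ v i.succ ≤ v k then 1 else 0)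
      = ∑ i : Fin n, ∑ k : Fin (n + 1),
          (if i.succ < k ∧ v i.succ < v i.castSucc then 1 else 0) +
        ∑ i : Fin n, ∑ k : Fin (n + 1), (if i.succ < k ∧ v i.castSucc ≤ v k then 1 else 0) +
        des v := by
    rw [stat, patternCount_two]
    simp only [patternCount_three]
    rw [add_right_comm, Nat.add_right_cancel_iff]
    simp only [← Finset.sum_add_distrib]
    refine Finset.sum_congr rfl fun i _ => Finset.sum_congr rfl fun k _ => ?_
    by_cases hk : i.succ < k
    · simp only [hk, true_and]
      exact sum_patterns _ _ _
    · simp only [hk, false_and, if_false]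
  -- Adding the missing terms k = i + 1 makes both double sums range over all later positions; they
  -- then differ by a shift of the index, and only the contribution of the first letter survives.
  have h2 : ∑ i : Fin n, ∑ k : Fin (n + 1),
      (if i.succ < k ∧ v i.castSucc ≤ v k then 1 else 0) +
      ∑ i : Fin n, (if v i.castSucc ≤ v i.succ then 1 else 0) =
      ∑ k : Fin (n + 1), (if 0 < k ∧ v 0 ≤ v k then 1 else 0) +
      ∑ i : Fin n, ∑ k : Fin (n + 1), (if i.succ < k ∧ v i.succ ≤ v k then 1 else 0) := by
    have h3 : ∀ i : Fin n, ∑ k : Fin (n + 1),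
        (if i.succ < k ∧ v i.castSucc ≤ v k then 1 else 0) +
        (if v i.castSucc ≤ v i.succ then 1 else 0) =
        ∑ k : Fin (n + 1), if i.castSucc < k ∧ v i.castSucc ≤ v k then 1 else 0 := by
      intro i
      have : (if v i.castSucc ≤ v i.succ then 1 else 0) = ∑ k : Fin (n + 1),
          if k = i.succ ∧ v i.castSucc ≤ v k then 1 else 0 := by
        simp [ite_and]
      rw [this, ← Finset.sum_add_distrib]
      refine Finset.sum_congr rfl fun k _ => ?_
      by_cases hk : v i.castSucc ≤ v k
      · simp only [hk, and_true, Fin.lt_def, Fin.ext_iff, Fin.val_succ, Fin.val_castSucc]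
        split_ifs <;> omega
      · simp [hk]
    have h4 := Fin.sum_univ_castSucc fun j : Fin (n + 1) => ∑ k : Fin (n + 1),
        if j < k ∧ v j ≤ v k then 1 else 0
    rw [Fin.sum_univ_succ] at h4
    rw [← Finset.sum_add_distrib]
    simp only [h3]
    rw [h4]
    simp [Fin.not_lt.2 (Fin.le_last _)]
  have h5 : ∑ i : Fin n, (if v i.castSucc ≤ v i.succ then 1 else 0) + des v = n := by
    rw [des_eq_sum, ← Finset.sum_add_distrib]
    conv_rhs => rw [← Fintype.card_fin n, ← Finset.card_univ, Finset.card_eq_sum_ones]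
    refine Finset.sum_congr rfl fun i _ => ?_
    simp only [← not_le]
    split_ifs <;> rfl
  have h6 : ∑ k : Fin (n + 1), (if 0 < k ∧ v 0 ≤ v k then 1 else 0) + firstRank v = n := by
    rw [firstRank, Finset.card_filter, Fin.sum_univ_succ, Fin.sum_univ_succ]
    simp only [lt_irrefl, false_and, if_false, zero_add, Fin.succ_pos, true_and]
    rw [← Finset.sum_add_distrib]
    conv_rhs => rw [← Fintype.card_fin n, ← Finset.card_univ, Finset.card_eq_sum_ones]
    refine Finset.sum_congr rfl fun i _ => ?_
    simp only [← not_le]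
    split_ifs <;> rfl
  -- A descent at one-based position p adds p to MAJ and has n - p positions beyond its second
  -- letter.
  have h7 : maj v + ∑ i : Fin n, ∑ k : Fin (n + 1),
      (if i.succ < k ∧ v i.succ < v i.castSucc then 1 else 0) = n * des v := by
    rw [maj_eq_sum, des_eq_sum, ← Finset.sum_add_distrib, Finset.mul_sum]
    refine Finset.sum_congr rfl fun i _ => ?_
    by_cases hi : v i.succ < v i.castSucc
    · simp only [hi, and_true, if_true, ← Finset.card_filter]
      rw [Finset.filter_lt_eq_Ioi, Fin.card_Ioi, Fin.val_succ]
      have := i.2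
      omega
    · simp [hi]
  have h8 : (n + 2) * des v = n * des v + des v + des v := by ring
  omega

/-! ### Standardization. -/

section Code

variable {α : Type*} [LinearOrder α] {n : ℕ}

theorem code_lt_code_iff (v : Fin n → α) (i j : Fin n) :
    code v i < code v j ↔ (v i < v j ∨ (v i = v j ∧ i < j)) :=
  (eq_code_iff v _).1 rfl i j

theorem code_coe (π : Equiv.Perm (Fin n)) : code π = π := by
  refine ((eq_code_iff _ _).2 fun i j => ⟨Or.inl, ?_⟩).symm
  rintro (h | ⟨h, h'⟩)
  · exact h
  · exact absurd (π.injective h) h'.ne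

theorem descentSet_code (v : Fin n → α) : descentSet (code v) = descentSet v := by
  unfold descentSet
  congr 1
  refine Finset.filter_congr fun i _ => exists_congr fun j => and_congr_right fun hj => ?_
  rw [code_lt_code_iff, or_iff_left]
  rintro ⟨-, h⟩
  rw [Fin.lt_def] at h
  omega

theorem des_code (v : Fin n → α) : des (code v) = des v := by
  rw [des, des, descentSet_code]

theorem maj_code (v : Fin n → α) : maj (code v) = maj v := by
  rw [maj, maj, descentSet_code]

theorem invDescentSet_code (v : Fin n → α) : invDescentSet (code v) = invDescentSet v := by
  rw [invDescentSet, code_coe]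
  rfl

theorem code_zero (v : Fin (n + 1) → α) : (code v 0 : ℕ) = firstRank v := by
  rw [firstRank, ← Fin.card_Iio]
  refine (Finset.card_bij (fun k _ => code v k) ?_ ?_ ?_).symm
  · intro k hk
    rw [Finset.mem_filter] at hk
    rw [Finset.mem_Iio, code_lt_code_iff]
    exact Or.inl hk.2
  · exact fun i _ j _ h => (code v).injective h
  · intro k hk
    refine ⟨(code v).symm k, ?_, by simp⟩
    rw [Finset.mem_Iio, ← (code v).apply_symm_apply k, code_lt_code_iff] at hk
    rw [Finset.mem_filter]
    exact ⟨Finset.mem_univ _, hk.resolve_right fun h => absurd h.2 (Fin.not_lt_zero _)⟩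

/-- No pattern needs to be followed through standardization: by `maj_add_stat`, STAT is determined
by MAJ, des and the rank of the first letter, all of which are preserved. -/
theorem stat_code (v : Fin (n + 1) → α) : stat (code v) = stat v := by
  have h1 := maj_add_stat v
  have h2 := maj_add_stat (code v)
  rw [← code_zero, code_coe, des_code, maj_code] at h2
  rw [← code_zero] at h1
  omega

theorem firstRank_of_mem_rearr {w v : Fin (n + 1) → α} (h : v ∈ rearr w) :
    firstRank v = (Finset.univ.filter fun k => w k < v 0).card := by
  obtain ⟨σ, -, rfl⟩ := Finset.mem_image.1 h
  refine Finset.card_bij (fun k _ => σ k) ?_ (fun i _ j _ h => σ.injective h) ?_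
  · intro k hk
    simpa using hk
  · intro k hk
    exact ⟨σ.symm k, by simpa using hk, by simp⟩

theorem mem_invDescentSet (v : Fin (n + 1) → α) (m : ℕ) : m ∈ invDescentSet v ↔
    ∃ a : Fin n, m = a + 1 ∧ (code v).symm a.succ < (code v).symm a.castSucc := by
  simp only [invDescentSet, Finset.mem_image, Finset.mem_filter, Finset.mem_univ, true_and]
  constructor
  · rintro ⟨i, ⟨j, hji, hj⟩, rfl⟩
    have hlt : (code v i : ℕ) < n := by have := (code v j).2; omega
    refine ⟨⟨code v i, hlt⟩, rfl, ?_⟩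
    have h1 : (⟨code v i, hlt⟩ : Fin n).castSucc = code v i := rfl
    have h2 : (⟨code v i, hlt⟩ : Fin n).succ = code v j := Fin.ext hj.symm
    rw [h1, h2]
    simpa using hji
  · rintro ⟨a, rfl, h⟩
    exact ⟨_, ⟨_, h, by simp⟩, by simp⟩

theorem succ_mem_invDescentSet (π : Equiv.Perm (Fin (n + 1))) (a : Fin n) :
    (a : ℕ) + 1 ∈ invDescentSet π ↔ π.symm a.succ < π.symm a.castSucc := by
  rw [mem_invDescentSet, code_coe]
  constructor
  · rintro ⟨b, h, h'⟩
    rwa [show a = b from Fin.ext (by omega)]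
  · exact fun h => ⟨a, rfl, h⟩

/-- Standardization numbers equal letters from left to right, so two consecutive values may come
from the same letter only if they appear in π in increasing order. -/
theorem code_comp_eq_iff {s : Fin (n + 1) → α} (hs : Monotone s) (π : Equiv.Perm (Fin (n + 1))) :
    code (s ∘ π) = π ↔
      ∀ a : Fin n, (a : ℕ) + 1 ∈ invDescentSet π → s a.castSucc < s a.succ := by
  constructor
  · intro h a ha
    rw [succ_mem_invDescentSet] at ha
    refine lt_of_le_of_ne (hs Fin.castSucc_lt_succ.le) fun he => ?_
    have h1 := (eq_code_iff _ _).1 h.symm (π.symm a.succ) (π.symm a.castSucc)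
    simp only [Function.comp_apply, Equiv.apply_symm_apply] at h1
    exact absurd (h1.2 (Or.inr ⟨he.symm, ha⟩)) Fin.castSucc_lt_succ.asymm
  · intro h
    -- Along a block on which s is constant there is no inverse descent, so the positions of its
    -- consecutive values increase.
    have step : ∀ a b : Fin (n + 1), a < b → s a = s b → π.symm a < π.symm b := by
      intro a b
      induction b using Fin.induction with
      | zero => exact fun h => absurd h (Fin.not_lt_zero _)
      | succ j ih =>
        intro hab he
        have haj : a ≤ j.castSucc := Fin.le_castSucc_iff.2 hab
        have he' : s j.castSucc = s j.succ :=
          le_antisymm (hs Fin.castSucc_lt_succ.le) (he ▸ hs haj)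
        have hj : π.symm j.castSucc < π.symm j.succ := by
          refine lt_of_le_of_ne (not_lt.1 fun hlt => ?_) fun h =>
            Fin.castSucc_lt_succ.ne (π.symm.injective h)
          exact (h j ((succ_mem_invDescentSet _ _).2 hlt)).ne he'
        rcases haj.lt_or_eq with hlt | rfl
        · exact (ih hlt (he.trans he'.symm)).trans hj
        · exact hj
    have main : ∀ i j, π i < π j → (s (π i) < s (π j) ∨ (s (π i) = s (π j) ∧ i < j)) := by
      intro i j hij
      rcases (hs hij.le).lt_or_eq with h | h
      · exact Or.inl h
      · exact Or.inr ⟨h, by simpa using step _ _ hij h⟩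
    refine ((eq_code_iff _ _).2 fun i j => ⟨main i j, fun hij => ?_⟩).symm
    rcases lt_trichotomy (π i) (π j) with h1 | h1 | h1
    · exact h1
    · cases π.injective h1
      simp at hij
    · rcases main j i h1 with h2 | ⟨h2, h3⟩ <;> rcases hij with h4 | ⟨h4, h5⟩
      · exact absurd h2 h4.asymm
      · exact absurd h4 h2.ne'
      · exact absurd h2 h4.ne'
      · exact absurd h3 h5.asymm

theorem comp_code_of_mem_rearr {s v : Fin n → α} (hs : Monotone s) (hv : v ∈ rearr s) :
    s ∘ code v = v := by
  obtain ⟨σ, -, rfl⟩ := Finset.mem_image.1 hv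
  have h1 := Tuple.comp_perm_comp_sort_eq_comp_sort (f := s) (σ := σ)
  rw [Tuple.sort_eq_refl_iff_monotone.2 hs] at h1
  funext i
  have := congrFun h1 ((Tuple.sort (s ∘ σ)).symm i)
  simpa [code] using this.symm

/-- Composition with s inverts standardization, and `code_comp_eq_iff` identifies the image. -/
theorem card_filter_code {s : Fin (n + 1) → α} (hs : Monotone s)
    (Q : Equiv.Perm (Fin (n + 1)) → Prop) [DecidablePred Q] :
    ((rearr s).filter fun v => Q (code v)).card =
      (Finset.univ.filter fun π : Equiv.Perm (Fin (n + 1)) =>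
        (∀ a : Fin n, (a : ℕ) + 1 ∈ invDescentSet π → s a.castSucc < s a.succ) ∧ Q π).card := by
  refine Finset.card_nbij' code (fun π => s ∘ π) ?_ ?_ ?_ ?_
  · intro v hv
    simp only [Finset.coe_filter, Set.mem_ofPred_eq, Finset.mem_univ, true_and] at hv ⊢
    refine ⟨(code_comp_eq_iff hs _).1 ?_, hv.2⟩
    rw [comp_code_of_mem_rearr hs hv.1]
  · intro π hπ
    simp only [Finset.coe_filter, Set.mem_ofPred_eq, Finset.mem_univ, true_and] at hπ ⊢
    rw [(code_comp_eq_iff hs π).2 hπ.1]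
    exact ⟨Finset.mem_image_of_mem _ (Finset.mem_univ _), hπ.2⟩
  · intro v hv
    simp only [Finset.coe_filter, Set.mem_ofPred_eq] at hv
    exact comp_code_of_mem_rearr hs hv.1
  · intro π hπ
    simp only [Finset.coe_filter, Set.mem_ofPred_eq, Finset.mem_univ, true_and] at hπ
    exact (code_comp_eq_iff hs π).2 hπ.1

theorem card_code_maj_stat_symm {s : Fin (n + 1) → α} (hs : Monotone s) (k : Fin (n + 1))
    (b x y : ℕ) :
    ((rearr s).filter fun v => code v 0 = k ∧ des (code v) = b ∧ maj (code v) = x ∧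
      stat (code v) = y).card =
    ((rearr s).filter fun v => code v 0 = k ∧ des (code v) = b ∧ maj (code v) = y ∧
      stat (code v) = x).card := by
  have hk : ∀ v ∈ rearr s, code v 0 = k → v 0 = s k := by
    rintro v hv rfl
    exact (congrFun (comp_code_of_mem_rearr hs hv) 0).symm
  -- If `code v 0 = k`, the first letter is `s k` and k counts the letters below it. When k is of
  -- this kind and x, y fit the linear relation, the conditions reduce to first letter, des and MAJ;
  -- otherwise both sides are empty.
  by_cases h : (Finset.univ.filter fun j => s j < s k).card = k ∧ x + y + k = (n + 2) * b
  · have key : ∀ x y, x + y + k = (n + 2) * b →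
        ((rearr s).filter fun v => code v 0 = k ∧ des (code v) = b ∧ maj (code v) = x ∧
          stat (code v) = y) =
        (rearr s).filter fun v => v 0 = s k ∧ des v = b ∧ maj v = x := by
      intro x y hxy
      refine Finset.filter_congr fun v hv => ?_
      rw [des_code, maj_code, stat_code]
      constructor
      · rintro ⟨h1, h2, h3, -⟩
        exact ⟨hk v hv h1, h2, h3⟩
      · rintro ⟨h1, h2, h3⟩
        have h4 : firstRank v = k := by rw [firstRank_of_mem_rearr hv, h1, h.1]
        refine ⟨Fin.ext (by rw [code_zero, h4]), h2, h3, ?_⟩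
        have := maj_add_stat v
        rw [h2, h3, h4] at this
        omega
    rw [key x y h.2, key y x (by omega)]
    refine card_des_maj_symm s (s k) b x y fun v hv h1 => ?_
    rw [firstRank_of_mem_rearr hv, h1, h.1, h.2]
  · have key : ∀ v ∈ rearr s, ∀ x' y', x' + y' = x + y →
        ¬ (code v 0 = k ∧ des (code v) = b ∧ maj (code v) = x' ∧ stat (code v) = y') := by
      rintro v hv x' y' hxy ⟨h1, h2, h3, h4⟩
      have h5 := code_zero v
      refine h ⟨?_, ?_⟩
      · rw [← hk v hv h1, ← firstRank_of_mem_rearr hv, ← h5, h1]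
      · have := maj_add_stat v
        rw [← h5, h1, ← maj_code, ← stat_code, ← des_code, h2, h3, h4] at this
        omega
    rw [Finset.filter_false_of_mem fun v hv => key v hv _ _ rfl,
      Finset.filter_false_of_mem fun v hv => key v hv _ _ (add_comm _ _)]

end Code

/-! ### Inclusion–exclusion over inverse descent sets. -/

theorem eq_of_sum_powerset_eq {ι : Type*} [DecidableEq ι] (F G : Finset ι → ℕ)
    (h : ∀ T : Finset ι, ∑ S ∈ T.powerset, F S = ∑ S ∈ T.powerset, G S) (T : Finset ι) : F T = G T := by
  induction T using Finset.strongInduction with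
  | H T ih =>
    have h1 := h T
    rw [← Finset.sum_erase_add _ _ (Finset.mem_powerset_self T),
      ← Finset.sum_erase_add _ _ (Finset.mem_powerset_self T),
      Finset.sum_congr rfl fun S hS => ih S ?_] at h1
    · exact Nat.add_left_cancel h1
    · rw [Finset.mem_erase, Finset.mem_powerset] at hS
      exact hS.2.ssubset_of_ne hS.1

theorem card_subset_maj_stat_symm {n : ℕ} (T : Finset ℕ) (k : Fin (n + 1)) (b x y : ℕ) :
    (Finset.univ.filter fun π : Equiv.Perm (Fin (n + 1)) => invDescentSet π ⊆ T ∧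
      π 0 = k ∧ des π = b ∧ maj π = x ∧ stat π = y).card =
    (Finset.univ.filter fun π : Equiv.Perm (Fin (n + 1)) => invDescentSet π ⊆ T ∧
      π 0 = k ∧ des π = b ∧ maj π = y ∧ stat π = x).card := by
  -- A sorted word whose strict increases occur exactly at the elements of T between 1 and n; other
  -- elements of T can never be inverse descents.
  let s : Fin (n + 1) → ℕ := fun a => (T.filter (· ≤ (a : ℕ))).card
  have hs : Monotone s := fun a b hab =>
    Finset.card_le_card <| Finset.monotone_filter_right T fun t _ ht =>
      ht.trans (Fin.le_def.1 hab)
  have hT : ∀ a : Fin n, s a.castSucc < s a.succ ↔ (a : ℕ) + 1 ∈ T := by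
    intro a
    have h1 : T.filter (· ≤ (a.succ : ℕ)) =
        T.filter (· ≤ (a.castSucc : ℕ)) ∪ T.filter (· = (a : ℕ) + 1) := by
      rw [← Finset.filter_or]
      refine Finset.filter_congr fun t _ => ?_
      simp only [Fin.val_succ, Fin.val_castSucc]
      omega
    have h2 : s a.succ = s a.castSucc + (T.filter (· = (a : ℕ) + 1)).card := by
      change (T.filter (· ≤ (a.succ : ℕ))).card = _
      rw [h1, Finset.card_union_of_disjoint]
      refine Finset.disjoint_filter.2 fun t _ ht => ?_
      simp only [Fin.val_castSucc] at ht
      omega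
    rw [h2, Nat.lt_add_right_iff_pos, Finset.card_pos]
    constructor
    · rintro ⟨t, ht⟩
      rw [Finset.mem_filter] at ht
      exact ht.2 ▸ ht.1
    · exact fun h => ⟨_, Finset.mem_filter.2 ⟨h, rfl⟩⟩
  have hsub : ∀ π : Equiv.Perm (Fin (n + 1)), invDescentSet π ⊆ T ↔
      ∀ a : Fin n, (a : ℕ) + 1 ∈ invDescentSet π → s a.castSucc < s a.succ := by
    intro π
    simp only [hT]
    refine ⟨fun h a ha => h ha, fun h m hm => ?_⟩
    obtain ⟨a, rfl, -⟩ := (mem_invDescentSet _ _).1 hm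
    exact h a hm
  simp only [hsub]
  have h := card_code_maj_stat_symm hs k b x y
  rwa [card_filter_code hs fun π => π 0 = k ∧ des π = b ∧ maj π = x ∧ stat π = y,
    card_filter_code hs fun π => π 0 = k ∧ des π = b ∧ maj π = y ∧ stat π = x] at h

theorem card_invDescentSet_maj_stat_symm {n : ℕ} (T : Finset ℕ) (k : Fin (n + 1)) (b x y : ℕ) :
    (Finset.univ.filter fun π : Equiv.Perm (Fin (n + 1)) => invDescentSet π = T ∧
      π 0 = k ∧ des π = b ∧ maj π = x ∧ stat π = y).card =
    (Finset.univ.filter fun π : Equiv.Perm (Fin (n + 1)) => invDescentSet π = T ∧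
      π 0 = k ∧ des π = b ∧ maj π = y ∧ stat π = x).card := by
  have key : ∀ (T : Finset ℕ) (x y : ℕ), ∑ S ∈ T.powerset,
      (Finset.univ.filter fun π : Equiv.Perm (Fin (n + 1)) => invDescentSet π = S ∧
        π 0 = k ∧ des π = b ∧ maj π = x ∧ stat π = y).card =
      (Finset.univ.filter fun π : Equiv.Perm (Fin (n + 1)) => invDescentSet π ⊆ T ∧
        π 0 = k ∧ des π = b ∧ maj π = x ∧ stat π = y).card := by
    intro T x y
    rw [Finset.card_eq_sum_card_fiberwise
      (f := fun π : Equiv.Perm (Fin (n + 1)) => invDescentSet π) (t := T.powerset)]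
    · refine Finset.sum_congr rfl fun S hS => ?_
      rw [Finset.filter_filter]
      congr 1
      refine Finset.filter_congr fun π _ => ?_
      rw [Finset.mem_powerset] at hS
      constructor
      · rintro ⟨rfl, h⟩; exact ⟨⟨hS, h⟩, rfl⟩
      · rintro ⟨⟨-, h⟩, rfl⟩; exact ⟨rfl, h⟩
    · intro π hπ
      simp only [Finset.coe_filter, Set.mem_ofPred_eq, Finset.mem_univ, true_and] at hπ
      simpa using hπ.1
  exact eq_of_sum_powerset_eq
    (fun T => (Finset.univ.filter fun π : Equiv.Perm (Fin (n + 1)) => invDescentSet π = T ∧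
      π 0 = k ∧ des π = b ∧ maj π = x ∧ stat π = y).card)
    (fun T => (Finset.univ.filter fun π : Equiv.Perm (Fin (n + 1)) => invDescentSet π = T ∧
      π 0 = k ∧ des π = b ∧ maj π = y ∧ stat π = x).card)
    (fun T => by rw [key, key, card_subset_maj_stat_symm]) T

/-- Summing over the exact values of Id and of the first entry allows any joint condition on them.
-/
theorem card_maj_stat_symm {n : ℕ} (C : Finset ℕ → Fin (n + 1) → Prop)
    [∀ T k, Decidable (C T k)] (b x y : ℕ) :
    (Finset.univ.filter fun π : Equiv.Perm (Fin (n + 1)) => C (invDescentSet π) (π 0) ∧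
      des π = b ∧ maj π = x ∧ stat π = y).card =
    (Finset.univ.filter fun π : Equiv.Perm (Fin (n + 1)) => C (invDescentSet π) (π 0) ∧
      des π = b ∧ maj π = y ∧ stat π = x).card := by
  have key : ∀ x y, (Finset.univ.filter fun π : Equiv.Perm (Fin (n + 1)) =>
      C (invDescentSet π) (π 0) ∧ des π = b ∧ maj π = x ∧ stat π = y).card =
      ∑ p ∈ Finset.univ.image fun π : Equiv.Perm (Fin (n + 1)) => (invDescentSet π, π 0),
        if C p.1 p.2 then (Finset.univ.filter fun π : Equiv.Perm (Fin (n + 1)) =>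
          invDescentSet π = p.1 ∧ π 0 = p.2 ∧ des π = b ∧ maj π = x ∧ stat π = y).card else 0 := by
    intro x y
    rw [Finset.card_eq_sum_card_fiberwise
      (f := fun π : Equiv.Perm (Fin (n + 1)) => (invDescentSet π, π 0))
      (fun π _ => Finset.mem_coe.2 (Finset.mem_image_of_mem _ (Finset.mem_univ π)))]
    refine Finset.sum_congr rfl fun p _ => ?_
    rw [Finset.filter_filter]
    split_ifs with h
    · congr 1
      refine Finset.filter_congr fun π _ => ?_
      constructor
      · rintro ⟨⟨-, h'⟩, rfl⟩; exact ⟨rfl, rfl, h'⟩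
      · rintro ⟨h1, h2, h3⟩; exact ⟨⟨h1 ▸ h2 ▸ h, h3⟩, Prod.ext h1 h2⟩
    · rw [Finset.card_eq_zero, Finset.filter_eq_empty_iff]
      rintro π - ⟨⟨h1, -⟩, rfl⟩
      exact h h1
  rw [key, key]
  refine Finset.sum_congr rfl fun p _ => ?_
  rw [card_invDescentSet_maj_stat_symm]

end WordStat

/-! ### The equidistribution on a rearrangement class. -/

theorem mainTheorem3 {α : Type*} [LinearOrder α] {n : ℕ} (w : Fin n → α)
    (a b c : ℕ) (f : Option α) (x y : ℕ) :
    ((WordStat.rearr w).filter fun v =>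
        WordStat.imaj v = a ∧ WordStat.des v = b ∧ WordStat.ides v = c ∧
          WordStat.firstLetter v = f ∧ WordStat.maj v = x ∧ WordStat.stat v = y).card =
    ((WordStat.rearr w).filter fun v =>
        WordStat.imaj v = a ∧ WordStat.des v = b ∧ WordStat.ides v = c ∧
          WordStat.firstLetter v = f ∧ WordStat.stat v = x ∧ WordStat.maj v = y).card := by
  open WordStat in
  cases n with
  | zero =>
    refine congrArg Finset.card (Finset.filter_congr fun v _ => ?_)
    have h1 : maj v = 0 := by simp [maj, descentSet]
    have h2 : stat v = 0 := by
      have h3 : ∀ (k : ℕ) (p : Fin (k + 1) → ℕ) (A : Finset (Fin (k + 1))),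
          patternCount p A v = 0 := by
        intro k p A
        rw [patternCount, Finset.card_eq_zero, Finset.filter_eq_empty_iff]
        exact fun e => (e 0).elim0
      simp only [stat, h3]
    rw [h1, h2]
  | succ n =>
    set s := w ∘ Tuple.sort w with hs
    have hmono : Monotone s := Tuple.monotone_sort w
    have hrearr : rearr w = rearr s := by
      ext v
      rw [mem_rearr_iff, mem_rearr_iff,
        Multiset.coe_eq_coe.2 (Equiv.Perm.ofFn_comp_perm (Tuple.sort w) w)]
    -- After standardization, membership in the class, IMAJ, ides and the first letter `s (π 0)` are
    -- all conditions on Id and the first value alone.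
    have key : ∀ x y, ((rearr w).filter fun v => imaj v = a ∧ des v = b ∧ ides v = c ∧
        firstLetter v = f ∧ maj v = x ∧ stat v = y).card =
        (Finset.univ.filter fun π : Equiv.Perm (Fin (n + 1)) =>
          ((∀ i : Fin n, (i : ℕ) + 1 ∈ invDescentSet π → s i.castSucc < s i.succ) ∧
            ∑ j ∈ invDescentSet π, j = a ∧ (invDescentSet π).card = c ∧ some (s (π 0)) = f) ∧
          des π = b ∧ maj π = x ∧ stat π = y).card := by
      intro x y
      have h1 := card_filter_code hmono fun π => (∑ j ∈ invDescentSet π, j = a ∧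
        (invDescentSet π).card = c ∧ some (s (π 0)) = f) ∧ des π = b ∧ maj π = x ∧ stat π = y
      simp only [and_assoc] at h1 ⊢
      rw [← h1, hrearr]
      congr 1
      refine Finset.filter_congr fun v hv => ?_
      have h2 : s (code v 0) = v 0 := congrFun (comp_code_of_mem_rearr hmono hv) 0
      have h3 : firstLetter v = some (v 0) := by simp [firstLetter]
      rw [invDescentSet_code, des_code, maj_code, stat_code, h2, h3, imaj, ides]
      tauto
    have h := card_maj_stat_symm (fun T k =>
      (∀ i : Fin n, (i : ℕ) + 1 ∈ T → s i.castSucc < s i.succ) ∧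
        ∑ j ∈ T, j = a ∧ T.card = c ∧ some (s k) = f) b x y
    rw [key, h, ← key]
    congr 1
    refine Finset.filter_congr fun v _ => ?_
    tauto
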